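/- Let $\Lambda$ be an at most countable index set, let $\ell^2(\Lambda)$ be the real Hilbert space of square summable families $x=(x_\lambda)_{\lambda\in\Lambda}$, let $Y$ be a real Hilbert space, and let $F\colon \ell^2(\Lambda)\to Y$ be bounded linear. For $x\in\ell^2(\Lambda)$ put $\operatorname{supp}(x)=\{\lambda\in\Lambda : x_\lambda\neq 0\}$. Let $p\in(0,2)$, set $\mathcal R_p(x)=\sum_{\lambda\in\Lambda}|x_\lambda|^p\in[0,\infty]$, and for $y\in Y$ and $\beta\ge 0$ let $$\Sigma(F,y,\beta)=\operatorname{argmin}\{\mathcal R_p(x) : x\in\ell^2(\Lambda),\ \|Fx-y\|\le\beta\}$$ be the set of solutions of the constrained problem; the elements of $\Sigma(F,y,0)$ are called the $\mathcal R_p$-minimizing solutions of $Fx=y$. Let $\partial\mathcal R_p(x)\subset\ell^2(\Lambda)$ denote the (convex) subdifferential, that is, the set of $\xi$ such that $\mathcal R_p(z)\ge\mathcal R_p(x)+\langle\xi,z-x\rangle$ for all $z\in\ell^2(\Lambda)$; for $p>1$ it has at most one element and is identified with that element. **Proposition (Sparse Regularization).** Let $x^\dagger\in\ell^2(\Lambda)$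 be sparse, i.e. $\operatorname{supp}(x^\dagger)$ is finite. Assume that one of the following conditions holds: - $p\in(1,2)$, there exists $\omega\in Y$ with $\partial\mathcal R_p(x^\dagger)=F^*\omega$, and $F$ is injective on $V=\{x\in\ell^2(\Lambda):\operatorname{supp}(x)\subset\operatorname{supp}(x^\dagger)\}$; - $p=1$, there exist $\xi=(\xi_\lambda)_{\lambda\in\Lambda}\in\partial\mathcal R_1(x^\dagger)$ and $\omega\in Y$ with $\xi=F^*\omega$, and $F$ is injective on $V=\{x\in\ell^2(\Lambda):\operatorname{supp}(x)\subset\{\lambda\in\Lambda:|\xi_\lambda|=1\}\}$; - $p\in(0,1)$, $x^\dagger$ is the unique $\mathcal R_p$-minimizing solution of $Fx=Fx^\dagger$, and $F$ is injective on $V=\{x\in\ell^2(\Lambda):\operatorname{supp}(x)\subset\operatorname{supp}(x^\dagger)\}$. Then $$\sup\bigl\{\|x_\beta-x^\dagger\|_{\ell^2(\Lambda)} : y\in Y,\ \|Fx^\dagger-y\|\le\beta,\ x_\beta\in\Sigma(F,y,\beta)\bigr\}=\mathcal O\bigl(\beta^{\min\{1,1/p\}}\bigr)\quad\text{as }\beta\to0^+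 ;$$ in particular the supremum is finite for all sufficiently small $\beta>0$. -/

import Mathlib

open Filter Topology Asymptotics
open scoped ENNReal lp InnerProductSpace

/-- The functional `R_p(x) = ∑_λ |x_λ|^p` on `ℓ²(Λ)`, with values in `[0, ∞]`
(the sum of a family of nonnegative terms, equal to `∞` exactly when it diverges). -/
noncomputable def lpFunctional {Λ : Type*} (p : ℝ) (x : ℓ²(Λ, ℝ)) : ℝ≥0∞ :=
  ∑' l, ENNReal.ofReal (|x l| ^ p)

/-- The support `{λ : x_λ ≠ 0}` of a sequence. -/
def seqSupport {Λ : Type*} (x : ℓ²(Λ, ℝ)) : Set Λ := {l | x l ≠ 0}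

/-- A sequence is sparse if its support is finite. -/
def IsSparse {Λ : Type*} (x : ℓ²(Λ, ℝ)) : Prop := (seqSupport x).Finite

/-- The sequences in `ℓ²(Λ)` whose support is contained in `I`. -/
def supportedOn {Λ : Type*} (I : Set Λ) : Set ℓ²(Λ, ℝ) := {x | seqSupport x ⊆ I}

/-- The subdifferential at `x₀` of a functional `R : X → [0, ∞]` on a real Hilbert space `X`,
with dual space identified with `X`:
all `ξ` with `R(x) ≥ R(x₀) + ⟪ξ, x - x₀⟫` for every `x`, as an inequality in `[-∞, ∞]`. -/
def subdifferential {X : Type*} [NormedAddCommGroup X] [InnerProductSpace ℝ X]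
    (R : X → ℝ≥0∞) (x₀ : X) : Set X :=
  {ξ | ∀ x, (R x₀ : EReal) + ((⟪ξ, x - x₀⟫_ℝ : ℝ) : EReal) ≤ (R x : EReal)}

section ResidualMethod

variable {X Y : Type*} [NormedAddCommGroup Y]

/-- The feasible set `Φ(F, y, β) = {x : ‖F x - y‖ ≤ β}`. -/
def feasibleSet (F : X → Y) (y : Y) (β : ℝ) : Set X := {x | ‖F x - y‖ ≤ β}

/-- The value `v(F, y, β) = inf {R(x) : x ∈ Φ(F, y, β)}`. -/
noncomputable def residualValue (R : X → ℝ≥0∞) (F : X → Y) (y : Y) (β : ℝ) : ℝ≥0∞ :=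
  ⨅ x ∈ feasibleSet F y β, R x

/-- The set of regularized solutions
`Σ(F, y, β) = {x ∈ Φ(F, y, β) : R(x) = v(F, y, β)}`.
For `β = 0` these are the `R`-minimizing solutions of `F x = y`. -/
def solutionSet (R : X → ℝ≥0∞) (F : X → Y) (y : Y) (β : ℝ) : Set X :=
  {x ∈ feasibleSet F y β | R x = residualValue R F y β}

end ResidualMethod

/-- The set of errors
`{‖x_β - x₀‖ : y ∈ Y, ‖F x₀ - y‖ ≤ β, x_β ∈ Σ(F, y, β)}` for the functional `R`. -/
def errorSet {X Y : Type*} [NormedAddCommGroup X] [NormedAddCommGroup Y]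
    (R : X → ℝ≥0∞) (F : X → Y) (x₀ : X) (β : ℝ) : Set ℝ :=
  {e | ∃ y : Y, ‖F x₀ - y‖ ≤ β ∧ ∃ x ∈ solutionSet R F y β, e = ‖x - x₀‖}

/-! Only two facts about a regularized solution `x` matter: its functional value is at most that of
the true solution `x₀`, and `‖F x - F x₀‖ ≤ 2β`. Split `x = P x + z`, with `P` the restriction to a
finite set `J` carrying `x₀`. Being injective on a finite-dimensional space, `F` is bounded below
there, so `‖P x - x₀‖ ≤ K (2β + ‖F‖ ‖z‖)` and it remains to control `z`, for which `‖z‖ ≤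
R_p(z)^(1/p)` (`norm_le_lpFunctional_rpow`). For `p ≥ 1` the source condition gives `R_p(z) = O(β)`,
hence the rate `β^(1/p)` (`stability_of_source_condition`). For `p < 1`, weak compactness and
uniqueness force `P x → x₀`. Near `x₀` the functional is Lipschitz on `J`, so `R_p(z) ≤ L ‖P x -
x₀‖`; as `1/p > 1`, `z` is then negligible against `P x - x₀`, which leaves the linear rate
(`stability_of_lt_one`). -/

section FiniteRestriction

variable {Λ : Type*}

open Classical in
/-- The sequence that agrees with `x` on the finite set `J` and vanishes elsewhere. -/
noncomputable def seqRestrict (J : Finset Λ) (x : ℓ²(Λ, ℝ)) : ℓ²(Λ, ℝ) :=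
  ∑ l ∈ J, lp.single 2 l (x l)

open Classical in
theorem seqRestrict_apply (J : Finset Λ) (x : ℓ²(Λ, ℝ)) (l : Λ) :
    seqRestrict J x l = if l ∈ J then x l else 0 := by
  rw [seqRestrict, lp.coeFn_sum]
  refine (Finset.sum_apply l J _).trans ?_
  simp [Pi.single_apply]

theorem sub_seqRestrict_apply_of_mem {J : Finset Λ} (x : ℓ²(Λ, ℝ)) {l : Λ} (hl : l ∈ J) :
    (x - seqRestrict J x) l = 0 := by
  simp [seqRestrict_apply, hl]

theorem seqRestrict_mem_supportedOn (J : Finset Λ) (x : ℓ²(Λ, ℝ)) :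
    seqRestrict J x ∈ supportedOn (J : Set Λ) := by
  intro l hl
  by_contra h
  exact hl ((seqRestrict_apply J x l).trans (if_neg h))

theorem apply_eq_zero_of_mem_supportedOn {I : Set Λ} {x : ℓ²(Λ, ℝ)} (hx : x ∈ supportedOn I)
    {l : Λ} (hl : l ∉ I) : x l = 0 := by
  by_contra h
  exact hl (hx h)

/-- The linear subspace of the sequences supported on `I`. -/
def supportedOnSubmodule (I : Set Λ) : Submodule ℝ ℓ²(Λ, ℝ) where
  carrier := supportedOn I
  zero_mem' := fun l hl => absurd rfl hl
  add_mem' := fun {a b} ha hb l hl => by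
    by_contra h
    exact hl (by simp [apply_eq_zero_of_mem_supportedOn ha h,
      apply_eq_zero_of_mem_supportedOn hb h])
  smul_mem' := fun c x hx l hl => by
    by_contra h
    exact hl (by simp [apply_eq_zero_of_mem_supportedOn hx h])

theorem finiteDimensional_supportedOnSubmodule (J : Finset Λ) :
    FiniteDimensional ℝ (supportedOnSubmodule (J : Set Λ)) := by
  let T : supportedOnSubmodule (J : Set Λ) →ₗ[ℝ] (J → ℝ) :=
    { toFun := fun x l => x.1 l
      map_add' := fun x y => by ext l; simp
      map_smul' := fun c x => by ext l; simp }
  refine Module.Finite.of_injective T fun x y hxy => ?_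
  ext l
  by_cases hl : l ∈ J
  · exact congrFun hxy ⟨l, hl⟩
  · rw [apply_eq_zero_of_mem_supportedOn x.2 hl, apply_eq_zero_of_mem_supportedOn y.2 hl]

/-- A bounded linear operator that is injective on the sequences supported on a finite set is
bounded below there. -/
theorem exists_norm_le_of_injOn_supportedOn {Y : Type*} [NormedAddCommGroup Y] [NormedSpace ℝ Y]
    (F : ℓ²(Λ, ℝ) →L[ℝ] Y) (J : Finset Λ) (hF : Set.InjOn F (supportedOn (J : Set Λ))) :
    ∃ K : ℝ, 0 < K ∧ ∀ x ∈ supportedOn (J : Set Λ), ∀ y ∈ supportedOn (J : Set Λ),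
      ‖x - y‖ ≤ K * ‖F x - F y‖ := by
  have := finiteDimensional_supportedOnSubmodule J
  let G := F.toLinearMap.domRestrict (supportedOnSubmodule (J : Set Λ))
  have hG : LinearMap.ker G = ⊥ :=
    LinearMap.ker_eq_bot.2 fun x y hxy => Subtype.ext (hF x.2 y.2 hxy)
  obtain ⟨K, hK, h⟩ := G.exists_antilipschitzWith hG
  refine ⟨K, hK, fun x hx y hy => ?_⟩
  have := h.le_mul_dist ⟨x, hx⟩ ⟨y, hy⟩
  rwa [dist_eq_norm, dist_eq_norm] at this

end FiniteRestriction

/-! ### The functional and the embedding of `ℓᵖ` in `ℓ²`. -/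

section LpFunctional

variable {Λ : Type*} {p : ℝ}

theorem lpFunctional_eq_restrict_add (hp : 0 < p) (J : Finset Λ) (x : ℓ²(Λ, ℝ)) :
    lpFunctional p x
      = lpFunctional p (seqRestrict J x) + lpFunctional p (x - seqRestrict J x) := by
  rw [lpFunctional, lpFunctional, lpFunctional, ← ENNReal.tsum_add]
  refine tsum_congr fun l => ?_
  by_cases hl : l ∈ J <;> simp [seqRestrict_apply, hl, Real.zero_rpow hp.ne']

theorem lpFunctional_ne_top_of_isSparse (hp : 0 < p) {x : ℓ²(Λ, ℝ)} (hx : IsSparse x) :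
    lpFunctional p x ≠ ∞ := by
  rw [lpFunctional, tsum_eq_sum (s := hx.toFinset)]
  · exact ENNReal.sum_ne_top.2 fun _ _ => ENNReal.ofReal_ne_top
  · intro l hl
    have : x l = 0 := by simpa [seqSupport] using hl
    simp [this, Real.zero_rpow hp.ne']

theorem isSparse_of_mem_supportedOn {J : Finset Λ} {x : ℓ²(Λ, ℝ)}
    (hx : x ∈ supportedOn (J : Set Λ)) : IsSparse x :=
  J.finite_toSet.subset hx

theorem lpFunctional_seqRestrict_ne_top (hp : 0 < p) (J : Finset Λ) (x : ℓ²(Λ, ℝ)) :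
    lpFunctional p (seqRestrict J x) ≠ ∞ :=
  lpFunctional_ne_top_of_isSparse hp
    (isSparse_of_mem_supportedOn (seqRestrict_mem_supportedOn J x))

theorem hasSum_toReal_lpFunctional {x : ℓ²(Λ, ℝ)} (hx : lpFunctional p x ≠ ∞) :
    HasSum (fun l => |x l| ^ p) (lpFunctional p x).toReal := by
  have h := ENNReal.hasSum_toReal hx
  rw [← ENNReal.tsum_toReal_eq (ENNReal.ne_top_of_tsum_ne_top hx)] at h
  simp only [ENNReal.toReal_ofReal (Real.rpow_nonneg (abs_nonneg _) p)] at h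
  exact h

/-- The embedding `ℓᵖ ⊆ ℓ²` for `p ≤ 2` has norm at most one. -/
theorem norm_le_lpFunctional_rpow (hp : 0 < p) (hp2 : p ≤ 2) {x : ℓ²(Λ, ℝ)}
    (hx : lpFunctional p x ≠ ∞) : ‖x‖ ≤ (lpFunctional p x).toReal ^ (1 / p) := by
  have hs := hasSum_toReal_lpFunctional hx
  set M := (lpFunctional p x).toReal
  have hM : 0 ≤ M := ENNReal.toReal_nonneg
  have h2 : 0 < (2 : ℝ≥0∞).toReal := by simp
  refine lp.norm_le_of_tsum_le h2 (Real.rpow_nonneg hM _) ?_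
  have hle : ∀ l, |x l| ≤ M ^ (1 / p) := fun l => by
    rw [one_div, Real.le_rpow_inv_iff_of_pos (abs_nonneg _) hM hp]
    exact le_hasSum hs l fun j _ => Real.rpow_nonneg (abs_nonneg _) p
  -- Keep the factor `|x l| ^ p`, which sums to `M`, and bound the remaining `|x l| ^ (2 - p)`
  -- uniformly; the total is `M ^ (2 / p)`.
  have hterm : ∀ l, ‖x l‖ ^ (2 : ℝ≥0∞).toReal ≤ |x l| ^ p * M ^ (1 / p * (2 - p)) := fun l => by
    have hsplit : ‖x l‖ ^ (2 : ℝ≥0∞).toReal = |x l| ^ p * |x l| ^ (2 - p) := by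
      rw [← Real.rpow_add_of_nonneg (abs_nonneg _) hp.le (by linarith)]
      simp
    rw [hsplit, Real.rpow_mul hM]
    exact mul_le_mul_of_nonneg_left (Real.rpow_le_rpow (abs_nonneg _) (hle l) (by linarith))
      (Real.rpow_nonneg (abs_nonneg _) p)
  have htot := hasSum_le hterm (lp.hasSum_norm h2 x) (hs.mul_right _)
  rw [(lp.hasSum_norm h2 x).tsum_eq]
  refine htot.trans_eq ?_
  rw [← Real.rpow_mul hM, ENNReal.toReal_ofNat]
  rcases hM.eq_or_lt with h0 | h0
  · rw [← h0, zero_mul, Real.zero_rpow (by positivity)]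
  · rw [← Real.rpow_one_add' hM]
    · congr 1; field_simp; ring
    · have : 1 + 1 / p * (2 - p) = 2 / p := by field_simp; ring
      rw [this]; positivity

end LpFunctional

/-! ### Coordinatewise consequences of the subgradient inequality. -/

section Subgradients

theorem subdifferential_toReal_le {X : Type*} [NormedAddCommGroup X] [InnerProductSpace ℝ X]
    {R : X → ℝ≥0∞} {x₀ ξ : X} (hξ : ξ ∈ subdifferential R x₀) (h₀ : R x₀ ≠ ∞) {x : X}
    (hx : R x ≠ ∞) : (R x₀).toReal + ⟪ξ, x - x₀⟫_ℝ ≤ (R x).toReal := by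
  have := hξ x
  rw [← EReal.coe_ennreal_toReal h₀, ← EReal.coe_ennreal_toReal hx] at this
  exact_mod_cast this

variable {Λ : Type*} {p : ℝ}

/-- A subgradient of the `p`-th power functional is coordinatewise a subgradient of `|·| ^ p`. -/
theorem subdifferential_lpFunctional_apply {x₀ ξ : ℓ²(Λ, ℝ)}
    (hξ : ξ ∈ subdifferential (lpFunctional p) x₀) (h₀ : lpFunctional p x₀ ≠ ∞) (l : Λ) (t : ℝ) :
    |x₀ l| ^ p + t * ξ l ≤ |x₀ l + t| ^ p := by
  classical
  -- Only coordinate `l` changes; the identity is written additively because subtraction in `ℝ≥0∞`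
  -- truncates.
  have key : lpFunctional p (x₀ + lp.single 2 l t) + ENNReal.ofReal (|x₀ l| ^ p)
      = lpFunctional p x₀ + ENNReal.ofReal (|x₀ l + t| ^ p) := by
    have hj : ∀ j, (if j = l then 0 else ENNReal.ofReal
        (|(x₀ + lp.single 2 l t : ℓ²(Λ, ℝ)) j| ^ p))
        = if j = l then 0 else ENNReal.ofReal (|x₀ j| ^ p) := fun j => by
      by_cases hj : j = l <;> simp [hj]
    have hl : (x₀ + lp.single 2 l t : ℓ²(Λ, ℝ)) l = x₀ l + t := by simp
    rw [lpFunctional, lpFunctional, ENNReal.tsum_eq_add_tsum_ite l,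
      ENNReal.tsum_eq_add_tsum_ite (f := fun j => ENNReal.ofReal (|x₀ j| ^ p)) l,
      tsum_congr hj, hl]
    ring
  have hfin : lpFunctional p (x₀ + lp.single 2 l t) ≠ ∞ := fun h => by
    rw [h, top_add] at key
    exact ENNReal.add_ne_top.2 ⟨h₀, ENNReal.ofReal_ne_top⟩ key.symm
  have h := subdifferential_toReal_le hξ h₀ hfin
  have key' := congrArg ENNReal.toReal key
  rw [ENNReal.toReal_add hfin ENNReal.ofReal_ne_top, ENNReal.toReal_add h₀ ENNReal.ofReal_ne_top,
    ENNReal.toReal_ofReal (by positivity), ENNReal.toReal_ofReal (by positivity)] at key'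
  rw [add_sub_cancel_left, lp.inner_single_right] at h
  simp only [RCLike.inner_apply, conj_trivial] at h
  linarith

/-- For `p > 1` a subgradient vanishes outside the support of the base point. -/
theorem subgradient_apply_eq_zero (hp : 1 < p) {x₀ ξ : ℓ²(Λ, ℝ)}
    (hξ : ξ ∈ subdifferential (lpFunctional p) x₀) (h₀ : lpFunctional p x₀ ≠ ∞) {l : Λ}
    (hl : x₀ l = 0) : ξ l = 0 := by
  have h : ∀ t : ℝ, t * ξ l ≤ |t| ^ p := fun t => by
    simpa [hl, Real.zero_rpow (by linarith : p ≠ 0)] using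
      subdifferential_lpFunctional_apply hξ h₀ l t
  have hlim : Tendsto (fun t : ℝ => t ^ (p - 1)) (𝓝[>] 0) (𝓝 0) := by
    have : ContinuousAt (fun t : ℝ => t ^ (p - 1)) 0 :=
      Real.continuousAt_rpow_const _ _ (Or.inr (by linarith))
    simpa [ContinuousAt, Real.zero_rpow (by linarith : p - 1 ≠ 0)] using
      this.mono_left nhdsWithin_le_nhds
  -- Test with `t` and `-t`, then divide by `t`.
  have hle : ∀ᶠ t : ℝ in 𝓝[>] 0, |ξ l| ≤ t ^ (p - 1) := by
    filter_upwards [self_mem_nhdsWithin] with t ht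
    have ht : 0 < t := ht
    have h1 := h t
    have h2 := h (-t)
    rw [abs_neg] at h2
    rw [abs_of_pos ht, ← sub_add_cancel p 1, Real.rpow_add_one ht.ne'] at h1 h2
    exact abs_le.2 ⟨by nlinarith, by nlinarith⟩
  exact abs_nonpos_iff.1 (ge_of_tendsto hlim hle)

theorem abs_subgradient_le_one {x₀ ξ : ℓ²(Λ, ℝ)}
    (hξ : ξ ∈ subdifferential (lpFunctional 1) x₀) (h₀ : lpFunctional 1 x₀ ≠ ∞) (l : Λ) :
    |ξ l| ≤ 1 := by
  have h : ∀ t, |x₀ l| + t * ξ l ≤ |x₀ l + t| := fun t => by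
    simpa using subdifferential_lpFunctional_apply hξ h₀ l t
  have h1 := h 1
  have h2 := h (-1)
  have h3 := abs_add_le (x₀ l) 1
  have h4 := abs_add_le (x₀ l) (-1)
  rw [abs_neg] at h4
  rw [abs_one] at h3 h4
  exact abs_le.2 ⟨by linarith, by linarith⟩

/-- Setting coordinate `l` to zero gives `|x₀ l| ≤ x₀ l * ξ l`, so `|ξ l|` cannot be below one. -/
theorem abs_subgradient_eq_one {x₀ ξ : ℓ²(Λ, ℝ)}
    (hξ : ξ ∈ subdifferential (lpFunctional 1) x₀) (h₀ : lpFunctional 1 x₀ ≠ ∞) {l : Λ}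
    (hl : x₀ l ≠ 0) : |ξ l| = 1 := by
  refine le_antisymm (abs_subgradient_le_one hξ h₀ l) ?_
  have h : |x₀ l| + -x₀ l * ξ l ≤ 0 := by
    simpa using subdifferential_lpFunctional_apply hξ h₀ l (-x₀ l)
  have h1 : x₀ l * ξ l ≤ |x₀ l| * |ξ l| := by rw [← abs_mul]; exact le_abs_self _
  have h2 := abs_pos.2 hl
  nlinarith

/-- The coordinates of a square summable sequence that do not have modulus one are bounded away
from one as soon as all coordinates are at most one, and only finitely many have modulus one. -/
theorem exists_finset_abs_le_of_abs_le_one (ξ : ℓ²(Λ, ℝ)) (h : ∀ l, |ξ l| ≤ 1) :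
    ∃ J : Finset Λ, (J : Set Λ) = {l | |ξ l| = 1} ∧
      ∃ c : ℝ, 0 < c ∧ ∀ l ∉ J, |ξ l| ≤ 1 - c := by
  classical
  have hs : Tendsto (fun l => ‖ξ l‖ ^ (2 : ℝ≥0∞).toReal) cofinite (𝓝 0) :=
    (lp.hasSum_norm (by simp) ξ).summable.tendsto_cofinite_zero
  -- The threshold `1 / 2` leaves finitely many large coordinates; `c` then has to fit these and be
  -- below `1 / 2` for all others.
  have hfin : {l | 1 / 2 < |ξ l|}.Finite := by
    have : ∀ᶠ l in cofinite, ‖ξ l‖ ^ (2 : ℝ≥0∞).toReal < 1 / 4 :=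
      hs.eventually_lt_const (by norm_num)
    refine (eventually_cofinite.1 this).subset fun l hl => ?_
    have hl : 1 / 2 < |ξ l| := hl
    simp only [Set.mem_ofPred_eq, not_lt, ENNReal.toReal_ofNat, Real.rpow_ofNat, Real.norm_eq_abs]
    nlinarith
  have hJ : {l | |ξ l| = 1}.Finite := hfin.subset fun l hl => by
    have hl : |ξ l| = 1 := hl
    simp only [Set.mem_ofPred_eq, hl]; norm_num
  refine ⟨hJ.toFinset, hJ.coe_toFinset, ?_⟩
  have hev : ∀ᶠ c : ℝ in 𝓝[>] 0, ∀ l ∈ hfin.toFinset, |ξ l| ≠ 1 → |ξ l| ≤ 1 - c := by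
    rw [Finset.eventually_all]
    intro l _
    by_cases h1 : |ξ l| = 1
    · exact Eventually.of_forall fun c hc => absurd h1 hc
    · have : 0 < 1 - |ξ l| := sub_pos.2 (lt_of_le_of_ne (h l) h1)
      filter_upwards [nhdsWithin_le_nhds (Iio_mem_nhds this)] with c hc _
      have hc : c < 1 - |ξ l| := hc
      linarith
  obtain ⟨c, ⟨hc, hc2⟩, hc0⟩ := ((hev.and (nhdsWithin_le_nhds
    (Iio_mem_nhds (by norm_num : (0 : ℝ) < 1 / 2)))).and self_mem_nhdsWithin).exists
  refine ⟨c, hc0, fun l hl => ?_⟩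
  by_cases h2 : 1 / 2 < |ξ l|
  · exact hc l (hfin.mem_toFinset.2 h2) (by simpa using hl)
  · have hc2 : c < 1 / 2 := hc2
    linarith

end Subgradients

/-! ### From worst-case errors to a stability estimate. -/

section Reduction

variable {X Y : Type*} [NormedAddCommGroup Y]

theorem norm_sub_le_and_le_of_mem_solutionSet {R : X → ℝ≥0∞} {F : X → Y} {x₀ x : X} {y : Y}
    {β : ℝ} (hy : ‖F x₀ - y‖ ≤ β) (hx : x ∈ solutionSet R F y β) :
    ‖F x - F x₀‖ ≤ 2 * β ∧ R x ≤ R x₀ := by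
  refine ⟨?_, hx.2.trans_le (iInf₂_le x₀ hy)⟩
  have h1 : ‖F x - y‖ ≤ β := hx.1
  have := norm_sub_le_norm_sub_add_norm_sub (F x) y (F x₀)
  rw [norm_sub_rev y] at this
  linarith

/-- A stability estimate on the sublevel set of the true solution bounds the worst case error. -/
theorem errorSet_isBigO_of_stability [NormedAddCommGroup X] {R : X → ℝ≥0∞} {F : X → Y} {x₀ : X} {r C : ℝ}
    (h : ∀ᶠ β in 𝓝[>] (0 : ℝ), ∀ x, R x ≤ R x₀ → ‖F x - F x₀‖ ≤ 2 * β →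
      ‖x - x₀‖ ≤ C * β ^ r) :
    (∀ᶠ β in 𝓝[>] (0 : ℝ), BddAbove (errorSet R F x₀ β)) ∧
    (fun β : ℝ => sSup (errorSet R F x₀ β)) =O[𝓝[>] (0 : ℝ)] (fun β : ℝ => β ^ r) := by
  have hub : ∀ᶠ β in 𝓝[>] (0 : ℝ), ∀ e ∈ errorSet R F x₀ β, e ≤ C * β ^ r := by
    filter_upwards [h] with β hβ
    rintro e ⟨y, hy, x, hx, rfl⟩
    obtain ⟨h1, h2⟩ := norm_sub_le_and_le_of_mem_solutionSet hy hx
    exact hβ x h2 h1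
  -- An empty error set has `sSup` equal to `0`, so the bound must be nonnegative; `|C|` ensures
  -- this with no sign assumed on `C`.
  refine ⟨hub.mono fun β hβ => ⟨_, hβ⟩, IsBigO.of_bound |C| ?_⟩
  filter_upwards [hub, self_mem_nhdsWithin] with β hβ hpos
  have hpos : 0 < β := hpos
  have hr : 0 < β ^ r := Real.rpow_pos_of_pos hpos r
  rw [Real.norm_of_nonneg (Real.sSup_nonneg ?_), Real.norm_of_nonneg hr.le]
  · exact Real.sSup_le (fun e he => (hβ e he).trans
      (mul_le_mul_of_nonneg_right (le_abs_self C) hr.le)) (by positivity)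
  · rintro e ⟨y, -, x, -, rfl⟩
    exact norm_nonneg _

end Reduction

/-! ### The case `1 ≤ p < 2`: source conditions. -/

section ConvexCase

variable {Λ : Type*} {Y : Type*} [NormedAddCommGroup Y]

/-- The error of `x` relative to `x₀ ∈ supportedOn J` is controlled by the data misfit and the part
of `x` outside `J`. -/
theorem norm_seqRestrict_sub_le [NormedSpace ℝ Y] {F : ℓ²(Λ, ℝ) →L[ℝ] Y} {J : Finset Λ} {K β : ℝ}
    (hK : 0 < K) (hF : ∀ x ∈ supportedOn (J : Set Λ), ∀ y ∈ supportedOn (J : Set Λ),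
      ‖x - y‖ ≤ K * ‖F x - F y‖)
    {x₀ x : ℓ²(Λ, ℝ)} (h₀ : x₀ ∈ supportedOn (J : Set Λ)) (hx : ‖F x - F x₀‖ ≤ 2 * β) :
    ‖seqRestrict J x - x₀‖ ≤ K * (2 * β + ‖F‖ * ‖x - seqRestrict J x‖) := by
  refine (hF _ (seqRestrict_mem_supportedOn J x) _ h₀).trans (mul_le_mul_of_nonneg_left ?_ hK.le)
  have h : F (seqRestrict J x) - F x₀ = (F x - F x₀) - F (x - seqRestrict J x) := by
    rw [map_sub]; abel
  rw [h]
  exact (norm_sub_le _ _).trans (add_le_add hx (F.le_opNorm _))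

theorem toReal_lpFunctional_eq_add {p : ℝ} (hp : 0 < p) (J : Finset Λ) {x : ℓ²(Λ, ℝ)}
    (hx : lpFunctional p x ≠ ∞) :
    lpFunctional p (x - seqRestrict J x) ≠ ∞ ∧ (lpFunctional p x).toReal
      = (lpFunctional p (seqRestrict J x)).toReal
        + (lpFunctional p (x - seqRestrict J x)).toReal := by
  have h := lpFunctional_eq_restrict_add hp J x
  have hz : lpFunctional p (x - seqRestrict J x) ≠ ∞ := fun hz => hx (by rw [h, hz, add_top])
  refine ⟨hz, ?_⟩
  conv_lhs => rw [h]
  exact ENNReal.toReal_add (lpFunctional_seqRestrict_ne_top hp J x) hz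

variable [InnerProductSpace ℝ Y] [CompleteSpace Y]

/-- Stability under a source condition, for a subgradient `F* ω` that is strictly dominated by the
functional outside the finite set `J`. -/
theorem stability_of_source_condition {p : ℝ} (hp : 1 ≤ p) (hp2 : p < 2)
    {F : ℓ²(Λ, ℝ) →L[ℝ] Y} {J : Finset Λ} (hF : Set.InjOn F (supportedOn (J : Set Λ)))
    {x₀ : ℓ²(Λ, ℝ)} (h₀ : x₀ ∈ supportedOn (J : Set Λ)) {ω : Y}
    (hω : ContinuousLinearMap.adjoint F ω ∈ subdifferential (lpFunctional p) x₀) {c : ℝ}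
    (hc : 0 < c) (hdom : ∀ z : ℓ²(Λ, ℝ), (∀ l ∈ J, z l = 0) → lpFunctional p z ≠ ∞ →
      ⟪ContinuousLinearMap.adjoint F ω, z⟫_ℝ ≤ (1 - c) * (lpFunctional p z).toReal) :
    ∃ C : ℝ, ∀ᶠ β in 𝓝[>] (0 : ℝ), ∀ x, lpFunctional p x ≤ lpFunctional p x₀ →
      ‖F x - F x₀‖ ≤ 2 * β → ‖x - x₀‖ ≤ C * β ^ min 1 (1 / p) := by
  obtain ⟨K, hK, hKF⟩ := exists_norm_le_of_injOn_supportedOn F J hF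
  have hp0 : 0 < p := by linarith
  have hR₀ := lpFunctional_ne_top_of_isSparse hp0 (isSparse_of_mem_supportedOn h₀)
  have hp1 : 1 / p ≤ 1 := by rw [div_le_one hp0]; exact hp
  rw [min_eq_right hp1]
  set D := (2 * ‖ω‖ / c) ^ (1 / p)
  refine ⟨K * (2 + ‖F‖ * D) + D, ?_⟩
  filter_upwards [self_mem_nhdsWithin, nhdsWithin_le_nhds (Iio_mem_nhds one_pos)]
    with β hβ hβ1 x hx hFx
  have hβ : 0 < β := hβ
  have hβ1 : β < 1 := hβ1
  have hR : lpFunctional p x ≠ ∞ := ne_top_of_le_ne_top hR₀ hx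
  obtain ⟨hz, hadd⟩ := toReal_lpFunctional_eq_add hp0 J hR
  set z := x - seqRestrict J x
  -- The subgradient inequality is used at the restriction of `x`, not at `x`. With additivity it
  -- gives `R(z) ≤ -⟪F* ω, x - x₀⟫ + ⟪F* ω, z⟫ ≤ 2 ‖ω‖ β + (1 - c) R(z)`, whence the constant in
  -- `D`.
  have hsub := subdifferential_toReal_le hω hR₀ (lpFunctional_seqRestrict_ne_top hp0 J x)
  have hdz := hdom z (fun l hl => sub_seqRestrict_apply_of_mem x hl) hz
  have hle : (lpFunctional p x).toReal ≤ (lpFunctional p x₀).toReal := ENNReal.toReal_mono hR₀ hx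
  have hinner : ⟪ContinuousLinearMap.adjoint F ω, x - x₀⟫_ℝ
      = ⟪ContinuousLinearMap.adjoint F ω, seqRestrict J x - x₀⟫_ℝ
        + ⟪ContinuousLinearMap.adjoint F ω, z⟫_ℝ := by
    rw [← inner_add_right]; congr 1; simp only [z]; abel
  have hlow : -(‖ω‖ * (2 * β)) ≤ ⟪ContinuousLinearMap.adjoint F ω, x - x₀⟫_ℝ := by
    rw [ContinuousLinearMap.adjoint_inner_left, map_sub]
    have h1 := (abs_le.1 (abs_real_inner_le_norm ω (F x - F x₀))).1
    have h2 := mul_le_mul_of_nonneg_left hFx (norm_nonneg ω)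
    linarith
  have hRz : (lpFunctional p z).toReal ≤ 2 * ‖ω‖ / c * β := by
    rw [div_mul_eq_mul_div, le_div_iff₀ hc]
    linarith
  have hznorm : ‖z‖ ≤ D * β ^ (1 / p) := by
    rw [← Real.mul_rpow (by positivity) hβ.le]
    exact (norm_le_lpFunctional_rpow hp0 hp2.le hz).trans
      (Real.rpow_le_rpow ENNReal.toReal_nonneg hRz (by positivity))
  have hβp : β ≤ β ^ (1 / p) := Real.self_le_rpow_of_le_one hβ.le hβ1.le hp1
  have hP := norm_seqRestrict_sub_le hK hKF h₀ hFx
  have hsplit : x - x₀ = (seqRestrict J x - x₀) + z := by simp only [z]; abel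
  calc ‖x - x₀‖ ≤ ‖seqRestrict J x - x₀‖ + ‖z‖ := hsplit ▸ norm_add_le _ _
    _ ≤ K * (2 * β ^ (1 / p) + ‖F‖ * (D * β ^ (1 / p))) + D * β ^ (1 / p) := by
      refine add_le_add (hP.trans ?_) hznorm
      gcongr
    _ = (K * (2 + ‖F‖ * D) + D) * β ^ (1 / p) := by ring

/-- The subgradient vanishes off the support of `x₀`, so domination holds with `c = 1`. -/
theorem stability_of_one_lt {p : ℝ} (hp : 1 < p) (hp2 : p < 2) {F : ℓ²(Λ, ℝ) →L[ℝ] Y}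
    {x₀ : ℓ²(Λ, ℝ)} (h₀ : IsSparse x₀) (hF : Set.InjOn F (supportedOn (seqSupport x₀))) {ω : Y}
    (hω : ContinuousLinearMap.adjoint F ω ∈ subdifferential (lpFunctional p) x₀) :
    ∃ C : ℝ, ∀ᶠ β in 𝓝[>] (0 : ℝ), ∀ x, lpFunctional p x ≤ lpFunctional p x₀ →
      ‖F x - F x₀‖ ≤ 2 * β → ‖x - x₀‖ ≤ C * β ^ min 1 (1 / p) := by
  have hJ : (h₀.toFinset : Set Λ) = seqSupport x₀ := h₀.coe_toFinset
  refine stability_of_source_condition (J := h₀.toFinset) hp.le hp2 (by rwa [hJ])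
    (by rw [hJ]; exact fun _ h => h) hω one_pos fun z hz _ => ?_
  rw [sub_self, zero_mul]
  refine (hasSum_le (fun l => ?_) (lp.hasSum_inner (𝕜 := ℝ) _ z) hasSum_zero)
  by_cases hl : x₀ l = 0
  · rw [subgradient_apply_eq_zero hp hω
      (lpFunctional_ne_top_of_isSparse (by linarith) h₀) hl, inner_zero_left]
  · rw [hz l (by simpa [seqSupport] using hl), inner_zero_right]

/-- Here `J = {|ξ| = 1}` is finite and contains the support of `x₀`; off `J` the gap `c` between
`|ξ|` and one is uniform since `ξ` is square summable. -/
theorem stability_of_eq_one {F : ℓ²(Λ, ℝ) →L[ℝ] Y} {x₀ : ℓ²(Λ, ℝ)} (h₀ : IsSparse x₀) {ω : Y}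
    (hω : ContinuousLinearMap.adjoint F ω ∈ subdifferential (lpFunctional 1) x₀)
    (hF : Set.InjOn F (supportedOn {l | |ContinuousLinearMap.adjoint F ω l| = 1})) :
    ∃ C : ℝ, ∀ᶠ β in 𝓝[>] (0 : ℝ), ∀ x, lpFunctional 1 x ≤ lpFunctional 1 x₀ →
      ‖F x - F x₀‖ ≤ 2 * β → ‖x - x₀‖ ≤ C * β ^ min 1 (1 / (1 : ℝ)) := by
  have hR₀ := lpFunctional_ne_top_of_isSparse one_pos h₀
  obtain ⟨J, hJ, c, hc, hcJ⟩ := exists_finset_abs_le_of_abs_le_one _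
    (abs_subgradient_le_one hω hR₀)
  refine stability_of_source_condition (J := J) le_rfl one_lt_two (by rwa [hJ])
    (by rw [hJ]; exact fun l hl => abs_subgradient_eq_one hω hR₀ hl) hω hc fun z hz hzR => ?_
  refine hasSum_le (fun l => ?_) (lp.hasSum_inner (𝕜 := ℝ) _ z)
    ((hasSum_toReal_lpFunctional hzR).mul_left (1 - c))
  by_cases hl : l ∈ J
  · simp [hz l hl]
  · refine (real_inner_le_norm _ _).trans ?_
    rw [Real.rpow_one]
    exact mul_le_mul_of_nonneg_right (hcJ l hl) (abs_nonneg _)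

end ConvexCase

/-! ### The case `0 < p < 1`: weak compactness and local Lipschitz bounds. -/

section NonconvexCase

variable {Λ : Type*} {Y : Type*} [NormedAddCommGroup Y]

theorem norm_le_of_lpFunctional_le {p : ℝ} (hp : 0 < p) (hp2 : p ≤ 2) {x₀ x : ℓ²(Λ, ℝ)}
    (h₀ : lpFunctional p x₀ ≠ ∞) (hx : lpFunctional p x ≤ lpFunctional p x₀) :
    ‖x‖ ≤ (lpFunctional p x₀).toReal ^ (1 / p) :=
  (norm_le_lpFunctional_rpow hp hp2 (ne_top_of_le_ne_top h₀ hx)).trans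
    (Real.rpow_le_rpow ENNReal.toReal_nonneg (ENNReal.toReal_mono h₀ hx) (by positivity))

/-- Bounded ultrafilters on a Hilbert space converge weakly. -/
theorem exists_tendsto_inner_of_bounded {X : Type*} [NormedAddCommGroup X]
    [InnerProductSpace ℝ X] [CompleteSpace X] (g : Ultrafilter X) {M : ℝ}
    (hg : ∀ᶠ x in (g : Filter X), ‖x‖ ≤ M) :
    ∃ x₀ : X, ∀ v : X, Tendsto (fun x => ⟪x, v⟫_ℝ) g (𝓝 ⟪x₀, v⟫_ℝ) := by
  -- Riesz representation moves the question to the dual, where Banach–Alaoglu applies.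
  let T : X → WeakDual ℝ X := fun x => StrongDual.toWeakDual (InnerProductSpace.toDual ℝ X x)
  have hmem : T ⁻¹' (WeakDual.toStrongDual ⁻¹' Metric.closedBall (0 : StrongDual ℝ X) M) ∈ g := by
    filter_upwards [hg] with x hx
    simpa [T] using hx
  obtain ⟨f, -, hf⟩ := (WeakDual.isCompact_closedBall (0 : StrongDual ℝ X) M).ultrafilter_le_nhds
    (g.map T) (le_principal_iff.2 hmem)
  have hT : Tendsto T g (𝓝 f) := hf
  refine ⟨(InnerProductSpace.toDual ℝ X).symm (WeakDual.toStrongDual f), fun v => ?_⟩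
  have h := ((WeakDual.eval_continuous v).tendsto f).comp hT
  rw [InnerProductSpace.toDual_symm_apply]
  exact h

/-- Lower semicontinuity: each finite partial sum passes to the limit. -/
theorem lpFunctional_le_of_tendsto {p : ℝ} (hp : 0 < p) {g : Filter ℓ²(Λ, ℝ)} [g.NeBot]
    {x₁ : ℓ²(Λ, ℝ)} {M : ℝ≥0∞} (hg : ∀ᶠ x in g, lpFunctional p x ≤ M)
    (h : ∀ l, Tendsto (fun x : ℓ²(Λ, ℝ) => x l) g (𝓝 (x₁ l))) : lpFunctional p x₁ ≤ M := by
  rw [lpFunctional, ENNReal.tsum_eq_iSup_sum]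
  refine iSup_le fun s => ?_
  have hlim : Tendsto (fun x : ℓ²(Λ, ℝ) => ∑ l ∈ s, ENNReal.ofReal (|x l| ^ p)) g
      (𝓝 (∑ l ∈ s, ENNReal.ofReal (|x₁ l| ^ p))) :=
    tendsto_finsetSum s fun l _ => ENNReal.tendsto_ofReal
      ((h l).abs.rpow_const (Or.inr hp.le))
  exact le_of_tendsto hlim (hg.mono fun x hx => (ENNReal.sum_le_tsum s).trans hx)

/-- The filter of sequences with `R x ≤ R x₀` and data `F x` tending to `F x₀`. -/
def sublevelFilter {X Y : Type*} [TopologicalSpace Y] (R : X → ℝ≥0∞) (F : X → Y) (x₀ : X) :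
    Filter X :=
  comap F (𝓝 (F x₀)) ⊓ 𝓟 {x | R x ≤ R x₀}

variable [InnerProductSpace ℝ Y] [CompleteSpace Y]

/-- If `x₀` is the unique minimizing solution, coordinates converge along `sublevelFilter`. -/
theorem tendsto_apply_of_unique_minimizer {p : ℝ} (hp : 0 < p) (hp2 : p ≤ 2)
    {F : ℓ²(Λ, ℝ) →L[ℝ] Y} {x₀ : ℓ²(Λ, ℝ)} (h₀ : lpFunctional p x₀ ≠ ∞)
    (huniq : solutionSet (lpFunctional p) F (F x₀) 0 = {x₀}) (l : Λ) :
    Tendsto (fun x : ℓ²(Λ, ℝ) => x l) (sublevelFilter (lpFunctional p) F x₀) (𝓝 (x₀ l)) := by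
  classical
  -- An ultrafilter needs no subsequences: it has a weak limit `x₁`, which is again a minimizing
  -- solution and so equals `x₀`.
  rw [tendsto_iff_ultrafilter]
  intro g hg
  have hR : ∀ᶠ x in (g : Filter ℓ²(Λ, ℝ)), lpFunctional p x ≤ lpFunctional p x₀ :=
    hg (mem_inf_of_right (mem_principal_self _))
  have hFg : Tendsto F g (𝓝 (F x₀)) := tendsto_comap.mono_left (hg.trans inf_le_left)
  obtain ⟨x₁, hx₁⟩ := exists_tendsto_inner_of_bounded g
    (hR.mono fun x hx => norm_le_of_lpFunctional_le hp hp2 h₀ hx)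
  have hcoord : ∀ j, Tendsto (fun x : ℓ²(Λ, ℝ) => x j) g (𝓝 (x₁ j)) := fun j => by
    simpa [lp.inner_single_right] using hx₁ (lp.single 2 j (1 : ℝ))
  have hFx₁ : F x₁ = F x₀ := by
    refine ext_inner_right ℝ fun v => ?_
    have h1 := hx₁ (ContinuousLinearMap.adjoint F v)
    simp only [ContinuousLinearMap.adjoint_inner_right] at h1
    exact tendsto_nhds_unique h1 (hFg.inner tendsto_const_nhds)
  have hRx₁ := lpFunctional_le_of_tendsto hp hR hcoord
  have hmin : x₀ ∈ solutionSet (lpFunctional p) F (F x₀) 0 := huniq ▸ Set.mem_singleton x₀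
  have hfeas : x₁ ∈ feasibleSet F (F x₀) 0 := by simp [feasibleSet, hFx₁]
  have hsol : x₁ ∈ solutionSet (lpFunctional p) F (F x₀) 0 :=
    ⟨hfeas, le_antisymm (hRx₁.trans_eq hmin.2) (iInf₂_le x₁ hfeas)⟩
  rw [huniq] at hsol
  rw [← Set.mem_singleton_iff.1 hsol]
  exact hcoord l

/-- On finitely many coordinates, coordinatewise convergence is norm convergence. -/
theorem tendsto_seqRestrict {g : Filter ℓ²(Λ, ℝ)} {x₀ : ℓ²(Λ, ℝ)} (J : Finset Λ)
    (h₀ : x₀ ∈ supportedOn (J : Set Λ))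
    (h : ∀ l, Tendsto (fun x : ℓ²(Λ, ℝ) => x l) g (𝓝 (x₀ l))) :
    Tendsto (seqRestrict J) g (𝓝 x₀) := by
  classical
  have hx₀ : seqRestrict J x₀ = x₀ := by
    ext l
    rw [seqRestrict_apply]
    split_ifs with hl
    · rfl
    · exact (apply_eq_zero_of_mem_supportedOn h₀ hl).symm
  conv_rhs => rw [← hx₀]
  exact tendsto_finsetSum J fun l _ =>
    (((lp.singleContinuousLinearMap ℝ (fun _ : Λ => ℝ) 2 l).continuous.tendsto _).comp (h l))

/-- Away from zero, `|·| ^ p` is locally Lipschitz at a point. -/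
theorem eventually_abs_rpow_sub_le (p : ℝ) {a : ℝ} (ha : a ≠ 0) :
    ∃ L : ℝ, 0 < L ∧ ∀ᶠ t in 𝓝 a, |a| ^ p - |t| ^ p ≤ L * |t - a| := by
  have hd : DifferentiableAt ℝ (fun t : ℝ => |t| ^ p) a :=
    (differentiableAt_abs ha).rpow_const (Or.inl (abs_ne_zero.2 ha))
  obtain ⟨L, hL, h⟩ := hd.hasDerivAt.isBigO_sub.exists_pos
  refine ⟨L, hL, h.bound.mono fun t ht => ?_⟩
  rw [Real.norm_eq_abs, Real.norm_eq_abs] at ht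
  linarith [neg_abs_le (|t| ^ p - |a| ^ p)]

theorem toReal_lpFunctional_of_mem_supportedOn {p : ℝ} (hp : 0 < p) {J : Finset Λ}
    {x : ℓ²(Λ, ℝ)} (hx : x ∈ supportedOn (J : Set Λ)) :
    (lpFunctional p x).toReal = ∑ l ∈ J, |x l| ^ p := by
  refine (hasSum_toReal_lpFunctional (lpFunctional_ne_top_of_isSparse hp
    (isSparse_of_mem_supportedOn hx))).unique (hasSum_sum_of_ne_finset_zero fun l hl => ?_)
  rw [apply_eq_zero_of_mem_supportedOn hx hl, abs_zero, Real.zero_rpow hp.ne']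

/-- Near `x₀`, the decrease of the functional on the support of `x₀` is at most linear. -/
theorem eventually_toReal_lpFunctional_sub_le {p : ℝ} (hp : 0 < p) {x₀ : ℓ²(Λ, ℝ)}
    {J : Finset Λ} (hJ : (J : Set Λ) = seqSupport x₀) :
    ∃ L : ℝ, 0 ≤ L ∧ ∀ᶠ x in 𝓝 x₀, x ∈ supportedOn (J : Set Λ) →
      (lpFunctional p x₀).toReal - (lpFunctional p x).toReal ≤ L * ‖x - x₀‖ := by
  have hloc : ∀ l, ∃ L : ℝ, 0 < L ∧ (l ∈ J → ∀ᶠ t in 𝓝 (x₀ l),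
      |x₀ l| ^ p - |t| ^ p ≤ L * |t - x₀ l|) := fun l => by
    by_cases hl : l ∈ J
    · have hne : x₀ l ≠ 0 := by
        have : l ∈ seqSupport x₀ := hJ ▸ Finset.mem_coe.2 hl
        exact this
      obtain ⟨L, hL, h⟩ := eventually_abs_rpow_sub_le p hne
      exact ⟨L, hL, fun _ => h⟩
    · exact ⟨1, one_pos, fun h => absurd h hl⟩
  choose L hL hLe using hloc
  refine ⟨∑ l ∈ J, L l, Finset.sum_nonneg fun l _ => (hL l).le, ?_⟩
  have hev : ∀ᶠ x in 𝓝 x₀, ∀ l ∈ J, |x₀ l| ^ p - |x l| ^ p ≤ L l * |x l - x₀ l| := by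
    rw [Finset.eventually_all]
    intro l hl
    have hcont : Tendsto (fun x : ℓ²(Λ, ℝ) => x l) (𝓝 x₀) (𝓝 (x₀ l)) :=
      (lp.evalCLM ℝ (fun _ : Λ => ℝ) 2 l).continuous.tendsto x₀
    exact hcont.eventually (hLe l hl)
  filter_upwards [hev] with x hx hxJ
  rw [toReal_lpFunctional_of_mem_supportedOn hp hxJ,
    toReal_lpFunctional_of_mem_supportedOn hp (x := x₀) (J := J) (by rw [hJ]; exact fun _ h => h),
    ← Finset.sum_sub_distrib, Finset.sum_mul]
  refine Finset.sum_le_sum fun l hl => (hx l hl).trans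
    (mul_le_mul_of_nonneg_left ?_ (hL l).le)
  exact lp.norm_apply_le_norm two_ne_zero (x - x₀) l

theorem stability_of_lt_one {p : ℝ} (hp : 0 < p) (hp1 : p < 1) {F : ℓ²(Λ, ℝ) →L[ℝ] Y}
    {x₀ : ℓ²(Λ, ℝ)} (h₀ : IsSparse x₀) (hF : Set.InjOn F (supportedOn (seqSupport x₀)))
    (huniq : solutionSet (lpFunctional p) F (F x₀) 0 = {x₀}) :
    ∃ C : ℝ, ∀ᶠ β in 𝓝[>] (0 : ℝ), ∀ x, lpFunctional p x ≤ lpFunctional p x₀ →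
      ‖F x - F x₀‖ ≤ 2 * β → ‖x - x₀‖ ≤ C * β ^ min 1 (1 / p) := by
  set J := h₀.toFinset
  have hJ : (J : Set Λ) = seqSupport x₀ := h₀.coe_toFinset
  have hx₀J : x₀ ∈ supportedOn (J : Set Λ) := by rw [hJ]; exact fun _ h => h
  have hR₀ := lpFunctional_ne_top_of_isSparse hp h₀
  obtain ⟨K, hK, hKF⟩ := exists_norm_le_of_injOn_supportedOn F J (by rwa [hJ])
  obtain ⟨L, hL, hLe⟩ := eventually_toReal_lpFunctional_sub_le hp hJ
  have hp1' : 1 < 1 / p := by rw [lt_div_iff₀ hp]; linarith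
  have hP : Tendsto (seqRestrict J) (sublevelFilter (lpFunctional p) F x₀) (𝓝 x₀) :=
    tendsto_seqRestrict J hx₀J
      (tendsto_apply_of_unique_minimizer hp (by linarith) hR₀ huniq)
  -- Chosen so that `K * ‖F‖ * η ≤ 1 / 2` and `η ≤ 1`.
  set η := 1 / (2 * (K * ‖F‖ + 1))
  have hη : 0 < η := by positivity
  have hsmall : ∀ᶠ x in 𝓝 x₀, L ^ (1 / p) * ‖x - x₀‖ ^ (1 / p - 1) < η := by
    have : Tendsto (fun x => L ^ (1 / p) * ‖x - x₀‖ ^ (1 / p - 1)) (𝓝 x₀)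
        (𝓝 (L ^ (1 / p) * ‖x₀ - x₀‖ ^ (1 / p - 1))) :=
      (((continuous_id.sub continuous_const).norm.rpow_const
        fun _ => Or.inr (by linarith)).const_mul _ |>.tendsto x₀)
    rw [sub_self, norm_zero, Real.zero_rpow (by linarith), mul_zero] at this
    exact this.eventually_lt_const hη
  have hev : ∀ᶠ x in sublevelFilter (lpFunctional p) F x₀,
      (lpFunctional p x₀).toReal - (lpFunctional p (seqRestrict J x)).toReal
        ≤ L * ‖seqRestrict J x - x₀‖ ∧
      L ^ (1 / p) * ‖seqRestrict J x - x₀‖ ^ (1 / p - 1) < η := by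
    filter_upwards [hP.eventually hLe, hP.eventually hsmall] with x h1 h2
    exact ⟨h1 (seqRestrict_mem_supportedOn J x), h2⟩
  rw [sublevelFilter, eventually_inf_principal, eventually_comap] at hev
  obtain ⟨ε, hε, hball⟩ := Metric.eventually_nhds_iff.1 hev
  -- Both `D` and `‖z‖ ≤ η * D ≤ D` will be at most `4 * K * β`.
  refine ⟨8 * K, ?_⟩
  filter_upwards [self_mem_nhdsWithin, nhdsWithin_le_nhds (Iio_mem_nhds (half_pos hε))]
    with β hβ hβε x hx hFx
  have hβε : β < ε / 2 := hβε
  obtain ⟨hlip, hη'⟩ := hball (y := F x) (by rw [dist_eq_norm]; linarith) x rfl hx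
  obtain ⟨hz, hadd⟩ := toReal_lpFunctional_eq_add hp J (ne_top_of_le_ne_top hR₀ hx)
  have hle : (lpFunctional p x).toReal ≤ (lpFunctional p x₀).toReal := ENNReal.toReal_mono hR₀ hx
  have hPn := norm_seqRestrict_sub_le hK hKF hx₀J hFx
  set z := x - seqRestrict J x
  set D := ‖seqRestrict J x - x₀‖
  have hD : 0 ≤ D := norm_nonneg _
  have hzD : ‖z‖ ≤ η * D := by
    calc ‖z‖ ≤ (lpFunctional p z).toReal ^ (1 / p) :=
          norm_le_lpFunctional_rpow hp (by linarith) hz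
      _ ≤ (L * D) ^ (1 / p) :=
          Real.rpow_le_rpow ENNReal.toReal_nonneg (by linarith) (by positivity)
      _ = L ^ (1 / p) * D ^ (1 / p - 1) * D := by
          rw [Real.mul_rpow hL hD, mul_assoc, ← Real.rpow_add_one' hD (by linarith),
            sub_add_cancel]
      _ ≤ η * D := mul_le_mul_of_nonneg_right hη'.le hD
  have hKη : K * ‖F‖ * η ≤ 1 / 2 := by
    simp only [η]
    rw [mul_one_div, div_le_div_iff₀ (by positivity) two_pos]
    linarith
  have hη1 : η ≤ 1 := by
    simp only [η]
    rw [div_le_one (by positivity)]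
    linarith [mul_nonneg hK.le (norm_nonneg F)]
  -- `D ≤ 2 * K * β + K * ‖F‖ * η * D`, and the last term is absorbed as at most `D / 2`.
  have hDβ : D ≤ 4 * K * β := by
    have h1 : K * ‖F‖ * ‖z‖ ≤ K * ‖F‖ * (η * D) :=
      mul_le_mul_of_nonneg_left hzD (by positivity)
    have h2 : K * ‖F‖ * η * D ≤ 1 / 2 * D := mul_le_mul_of_nonneg_right hKη hD
    linarith
  rw [min_eq_left hp1'.le, Real.rpow_one]
  have hsplit : x - x₀ = (seqRestrict J x - x₀) + z := by simp only [z]; abel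
  have hzD' : η * D ≤ 1 * D := mul_le_mul_of_nonneg_right hη1 hD
  have := norm_add_le (seqRestrict J x - x₀) z
  rw [← hsplit] at this
  linarith

end NonconvexCase

theorem mainTheorem10 {Λ : Type*} [Countable Λ]
    {Y : Type*} [NormedAddCommGroup Y] [InnerProductSpace ℝ Y] [CompleteSpace Y]
    (p : ℝ) (hp : p ∈ Set.Ioo (0 : ℝ) 2)
    (xd : ℓ²(Λ, ℝ)) (hxd : IsSparse xd)
    (F : ℓ²(Λ, ℝ) →L[ℝ] Y)
    (hcond :
      (p ∈ Set.Ioo (1 : ℝ) 2 ∧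
        (∃ ω : Y, ContinuousLinearMap.adjoint F ω ∈ subdifferential (lpFunctional p) xd) ∧
        Set.InjOn F (supportedOn (seqSupport xd))) ∨
      (p = 1 ∧
        ∃ ξ ∈ subdifferential (lpFunctional 1) xd,
          (∃ ω : Y, ξ = ContinuousLinearMap.adjoint F ω) ∧
          Set.InjOn F (supportedOn {l | |ξ l| = 1})) ∨
      (p ∈ Set.Ioo (0 : ℝ) 1 ∧
        solutionSet (lpFunctional p) F (F xd) 0 = {xd} ∧
        Set.InjOn F (supportedOn (seqSupport xd)))) :
    (∀ᶠ β in 𝓝[>] (0 : ℝ), BddAbove (errorSet (lpFunctional p) F xd β)) ∧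
    (fun β : ℝ => sSup (errorSet (lpFunctional p) F xd β))
      =O[𝓝[>] (0 : ℝ)] (fun β : ℝ => β ^ min 1 (1 / p)) := by
  have key : ∃ C : ℝ, ∀ᶠ β in 𝓝[>] (0 : ℝ), ∀ x, lpFunctional p x ≤ lpFunctional p xd →
      ‖F x - F xd‖ ≤ 2 * β → ‖x - xd‖ ≤ C * β ^ min 1 (1 / p) := by
    rcases hcond with ⟨hp', ⟨ω, hω⟩, hF⟩ | ⟨rfl, ξ, hξ, ⟨ω, rfl⟩, hF⟩ | ⟨hp', huniq, hF⟩
    · exact stability_of_one_lt hp'.1 hp'.2 hxd hF hω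
    · exact stability_of_eq_one hxd hξ hF
    · exact stability_of_lt_one hp'.1 hp'.2 hxd hF huniq
  obtain ⟨C, hC⟩ := key
  exact errorSet_isBigO_of_stability hC
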